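/- There is an absolute constant $K$ such that the following holds. Let $\alpha > 0$ be a constant. Then there are constants $\kappa, c > 0$ (depending only on $\alpha$) such that for every integer $n_0$ there is an integer $n \ge n_0$ with the following property. Let $n^{-1/2+\alpha} \le \epsilon < 1$, let $s \le \kappa\, n^{1+\alpha}$ be a non-negative integer (for instance $s = s(n)$ with $s(n) = o(n^{1+\alpha})$, once $n_0$ is large enough), and let $\rho$ be a real number. Suppose that there is a randomized one-pass streaming algorithm with at most $s$ bits of memory which, on every unweighted $n$-vertex hypergraph $G=(V,E)$ with at most $n^K$ edges, whose edges $e_0, e_1, \dots, e_{m-1}$ are presented one by one, outputs a set of identifiers of edges forming an edge $(1-\epsilon)$-cover $F$ of $G$ with $\mathbb{E}\,|F| \le \rho\cdot|\mathrm{OPT}|$. Then $$\rho \;\ge\; c\cdot \frac{\log\log n}{\log n}\cdot\frac{1}{\epsilon}.$$ Here the edges of a hypergraph form a multiset of non-empty subsets of $V$, and every vertex lies in at least one edge; the identifier of an edge is its arrival time; $F \subseteq E$ is an edge $\delta$-cover if at least $\delta n$ vertices lie in some edge of $F$; $\mathrm{OPT}$ is an edge $1$-cover of $G$ of minimum cardinality;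 the memory bound applies to the memory image kept between the arrivals of two consecutive edges, and the random coins are not counted in it. -/

import Mathlib

open MeasureTheory

universe u

namespace EdgeCover

/-- An unweighted hypergraph on the `n` vertices `Fin n` with a multiset of `m` edges, listed in
their order of arrival. The identifier of an edge is its arrival time `t : Fin m`. Edges are
non-empty and there are no isolated vertices. -/
structure StreamHypergraph (n m : ℕ) where
  edge : Fin m → Finset (Fin n)
  edge_nonempty : ∀ t, (edge t).Nonempty
  no_isolated : ∀ v, ∃ t, v ∈ edge t

namespace StreamHypergraph

variable {n m : ℕ}

/-- `V(F)`: the vertices incident to the edges whose identifiers are in `F`. -/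
def coveredBy (G : StreamHypergraph n m) (F : Finset (Fin m)) : Finset (Fin n) :=
  F.biUnion G.edge

/-- `F` is an edge `δ`-cover of `G`: it covers at least `δ n` vertices. -/
def IsCover (G : StreamHypergraph n m) (δ : ℝ) (F : Finset (Fin m)) : Prop :=
  δ * (n : ℝ) ≤ ((G.coveredBy F).card : ℝ)

/-- The cardinality of an optimal edge `1`-cover of `G` (one exists, since no vertex is
isolated). -/
noncomputable def optCard (G : StreamHypergraph n m) : ℕ :=
  sInf {k : ℕ | ∃ F : Finset (Fin m), G.IsCover 1 F ∧ F.card = k}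

end StreamHypergraph

/-- A deterministic one-pass streaming algorithm with `s` bits of memory for `n`-vertex
hypergraphs. When the edge with identifier `t` arrives, the new memory image is a function of `t`,
of the vertex set of the edge, and of the old memory image. At the end of a stream of `m` edges
the algorithm outputs a set of identifiers, as a function of `m` and of the memory image.
No restriction is put on the way these functions are computed. -/
structure StreamAlg (n s : ℕ) where
  init : Fin s → Bool
  update : ℕ → Finset (Fin n) → (Fin s → Bool) → (Fin s → Bool)
  output : (m : ℕ) → (Fin s → Bool) → Finset (Fin m)

/-- The output of the algorithm on the stream `edge 0, edge 1, …, edge (m - 1)`. -/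
def StreamAlg.run {n s m : ℕ} (A : StreamAlg n s) (edge : Fin m → Finset (Fin n)) :
    Finset (Fin m) :=
  A.output m (Fin.foldl m (fun mem t => A.update t (edge t) mem) A.init)

/-- A randomized one-pass streaming algorithm with `s` bits of memory: its coin tosses
`ω : Ω` (which are not charged to the memory) select a deterministic one, and on every stream the
output is a random variable. -/
structure RandStreamAlg (n s : ℕ) where
  Ω : Type u
  [measurableSpace : MeasurableSpace Ω]
  P : Measure Ω
  [isProbabilityMeasure : IsProbabilityMeasure P]
  alg : Ω → StreamAlg n s
  measurableSet_run : ∀ (m : ℕ) (edge : Fin m → Finset (Fin n)) (F : Finset (Fin m)),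
    MeasurableSet {ω | (alg ω).run edge = F}

attribute [instance] RandStreamAlg.measurableSpace RandStreamAlg.isProbabilityMeasure

/-- `A`, whose memory has `s` bits, is an uncertified `(n, s, ε, ρ)`-algorithm for the hypergraphs
with at most `M` edges: on each of them it outputs the identifiers of an edge `(1 - ε)`-cover
whose expected cardinality is at most `ρ · |OPT|`. -/
def RandStreamAlg.IsUncertified {n s : ℕ} (A : RandStreamAlg.{u} n s) (M : ℕ) (ε ρ : ℝ) : Prop :=
  ∀ (m : ℕ), m ≤ M → ∀ G : StreamHypergraph n m,
    (∀ᵐ ω ∂A.P, G.IsCover (1 - ε) ((A.alg ω).run G.edge)) ∧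
    ∫ ω, (((A.alg ω).run G.edge).card : ℝ) ∂A.P ≤ ρ * (G.optCard : ℝ)

end EdgeCover

/-! Place an `a × b` grid with `b ≈ 1/(4ε)`, `a ≈ n/b` in the vertex set. Stream the graphs of `m =
8n²` random functions `f j : Fin a → Fin b`, then the complement of the graph of one `f i`. The
optimum is at most 2, but a small cover must name the identifier `i`, for two reasons. Two random
graphs share about `a/b = O(ε²n)` vertices, and with high probability no `f j` shares `t = O(ε²n)`
or more with `f i` (`card_exists_agree_le`). Without edge `i`, a cover must still reach `a - εn ≥
2εn` vertices of its graph, so it needs order `1/ε` edges (`le_card_mul_of_isCover`). The last edge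
reveals only `g = f i`, so an output of size at most `R` is a guess of `i` from `g` and the memory.
For a fixed memory image the correct guesses are independent events with expected number at most
`R`. An exponential moment and a union bound over the `2^s` images leave at most `m/8` of them for
most `f`, as `s ≤ n²/4` (`sum_correct_guesses_le`). This gives `ρ ≥ 1/(3200ε)`; the factor `log log
n / log n ≤ 1` only weakens the bound. -/

namespace EdgeCover

open Finset

/-! ### Exponential moments and guessing from a short description -/

/-- Exponential moment of the number of successes of independent events `f i ∈ P i`. -/
theorem sum_two_pow_card_le {ι G : Type*} [Fintype ι] [DecidableEq ι] [Fintype G] [DecidableEq G]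
    (hG : 0 < Fintype.card G) (P : ι → Finset G) :
    ∑ f : ι → G, (2 : ℝ) ^ (#{i | f i ∈ P i}) ≤
      (Fintype.card G : ℝ) ^ Fintype.card ι *
        Real.exp ((∑ i, (#(P i) : ℝ)) / Fintype.card G) := by
  have hG' : (0 : ℝ) < Fintype.card G := by exact_mod_cast hG
  -- As a product over coordinates, the moment factors when summed over all `f`.
  have h1 : ∀ f : ι → G, (2 : ℝ) ^ (#{i | f i ∈ P i}) =
      ∏ i, (if f i ∈ P i then (2 : ℝ) else 1) := by
    intro f
    rw [Finset.prod_ite]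
    simp
  have h2 : ∀ i, ∑ g : G, (if g ∈ P i then (2 : ℝ) else 1) =
      Fintype.card G * (1 + #(P i) / Fintype.card G) := by
    intro i
    have : ∀ g : G, (if g ∈ P i then (2 : ℝ) else 1) = 1 + if g ∈ P i then 1 else 0 := by
      intro g; split_ifs <;> norm_num
    rw [Finset.sum_congr rfl (fun g _ => this g), Finset.sum_add_distrib]
    simp
    field_simp
  calc ∑ f : ι → G, (2 : ℝ) ^ (#{i | f i ∈ P i})
      = ∑ f : ι → G, ∏ i, (if f i ∈ P i then (2 : ℝ) else 1) :=
        Finset.sum_congr rfl (fun f _ => h1 f)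
    _ = ∏ i, ∑ g : G, (if g ∈ P i then (2 : ℝ) else 1) := by
        rw [Fintype.prod_sum]
    _ = ∏ i, (Fintype.card G * (1 + #(P i) / Fintype.card G) : ℝ) :=
        Finset.prod_congr rfl (fun i _ => h2 i)
    _ ≤ ∏ i, (Fintype.card G * Real.exp (#(P i) / Fintype.card G) : ℝ) := by
        refine Finset.prod_le_prod (fun i _ => by positivity) (fun i _ => ?_)
        gcongr
        rw [add_comm]
        exact Real.add_one_le_exp _
    _ = _ := by
        rw [Finset.prod_mul_distrib, ← Real.exp_sum, Finset.sum_div]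
        simp

/-- Markov's inequality for the moment bounded in `sum_two_pow_card_le`. -/
theorem card_filter_mul_two_pow_le {X : Type*} [Fintype X] (Y : X → ℕ) (T : ℕ) :
    (#{x | T ≤ Y x} : ℝ) * 2 ^ T ≤ ∑ x, (2 : ℝ) ^ Y x := by
  calc (#{x | T ≤ Y x} : ℝ) * 2 ^ T = ∑ x with T ≤ Y x, (2 : ℝ) ^ T := by simp
    _ ≤ ∑ x with T ≤ Y x, (2 : ℝ) ^ Y x := by
        refine Finset.sum_le_sum (fun x hx => ?_)
        exact pow_le_pow_right₀ (by norm_num) (by simpa using hx)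
    _ ≤ _ := Finset.sum_le_sum_of_subset_of_nonneg (Finset.filter_subset _ _)
        (fun _ _ _ => by positivity)

/-- A bounded-size guess `S mem g` of an index `i` with `f i = g`, made from a short description
`mem = M f` of `f`, is correct for many `i` only for few `f`. -/
theorem card_many_correct_guesses_le {Mem G : Type*} [Fintype Mem] [Fintype G] [DecidableEq G]
    (hG : 0 < Fintype.card G) {m : ℕ} (M : (Fin m → G) → Mem) (S : Mem → G → Finset (Fin m))
    (R : ℝ) (hS : ∀ mem g, (#(S mem g) : ℝ) ≤ R) (T : ℕ) :
    (#{f : Fin m → G | T ≤ #{i | i ∈ S (M f) (f i)}} : ℝ) * 2 ^ T ≤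
      Fintype.card Mem * ((Fintype.card G : ℝ) ^ m * Real.exp R) := by
  have hG' : (0 : ℝ) < Fintype.card G := by exact_mod_cast hG
  have key : ∀ mem, ∑ f : Fin m → G, (2 : ℝ) ^ (#{i | i ∈ S mem (f i)}) ≤
      (Fintype.card G : ℝ) ^ m * Real.exp R := by
    intro mem
    have h := sum_two_pow_card_le hG (fun i : Fin m => ({g | i ∈ S mem g} : Finset G))
    simp only [Finset.mem_filter, Finset.mem_univ, true_and, Fintype.card_fin] at h
    refine h.trans ?_
    gcongr
    rw [div_le_iff₀ hG']
    -- Double counting: the expected number of correct guesses is the average of `#(S mem g)` over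
    -- `g`.
    have : ∑ i : Fin m, (#{g | i ∈ S mem g} : ℝ) = ∑ g : G, (#(S mem g) : ℝ) := by
      have := Finset.sum_card_bipartiteAbove_eq_sum_card_bipartiteBelow
        (s := (univ : Finset (Fin m))) (t := (univ : Finset G)) (fun i g => i ∈ S mem g)
      simp only [Finset.bipartiteAbove, Finset.bipartiteBelow, Finset.filter_univ_mem] at this
      exact_mod_cast this
    rw [this]
    calc ∑ g : G, (#(S mem g) : ℝ) ≤ ∑ g : G, R := Finset.sum_le_sum (fun g _ => hS mem g)
      _ = R * Fintype.card G := by simp [mul_comm]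
  calc _ ≤ ∑ f : Fin m → G, (2 : ℝ) ^ (#{i | i ∈ S (M f) (f i)}) :=
        card_filter_mul_two_pow_le _ _
    -- Union bound: summing over every `mem` removes the dependence of `M f` on `f`, at the cost of
    -- the factor `Fintype.card Mem`.
    _ ≤ ∑ f : Fin m → G, ∑ mem, (2 : ℝ) ^ (#{i | i ∈ S mem (f i)}) :=
        Finset.sum_le_sum (fun f _ => Finset.single_le_sum
          (f := fun mem => (2 : ℝ) ^ (#{i | i ∈ S mem (f i)}))
          (fun _ _ => by positivity) (Finset.mem_univ (M f)))
    _ = ∑ mem, ∑ f : Fin m → G, (2 : ℝ) ^ (#{i | i ∈ S mem (f i)}) := Finset.sum_comm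
    _ ≤ ∑ mem : Mem, (Fintype.card G : ℝ) ^ m * Real.exp R :=
        Finset.sum_le_sum (fun mem _ => key mem)
    _ = _ := by simp

/-- Summed over all `f`, the number of correct guesses. -/
theorem sum_correct_guesses_le {Mem G : Type*} [Fintype Mem] [Fintype G] [DecidableEq G]
    (hG : 0 < Fintype.card G) {m : ℕ} (M : (Fin m → G) → Mem) (S : Mem → G → Finset (Fin m))
    (R : ℝ) (hS : ∀ mem g, (#(S mem g) : ℝ) ≤ R) (T : ℕ)
    (hT : 8 * (Fintype.card Mem * Real.exp R) ≤ 2 ^ T) :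
    ∑ f : Fin m → G, (#{i | i ∈ S (M f) (f i)} : ℝ) ≤
      (Fintype.card G : ℝ) ^ m * (T + m / 8) := by
  have h := card_many_correct_guesses_le hG M S R hS T
  have hG' : (0 : ℝ) < (Fintype.card G : ℝ) ^ m := by
    have : (0 : ℝ) < Fintype.card G := by exact_mod_cast hG
    positivity
  have hB : (#{f : Fin m → G | T ≤ #{i | i ∈ S (M f) (f i)}} : ℝ) ≤
      (Fintype.card G : ℝ) ^ m / 8 := by
    have h2 : (0 : ℝ) < 2 ^ T := by positivity
    refine le_of_mul_le_mul_right (h.trans ?_) h2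
    nlinarith
  calc ∑ f : Fin m → G, (#{i | i ∈ S (M f) (f i)} : ℝ)
      ≤ ∑ f : Fin m → G, ((T : ℝ) + if T ≤ #{i | i ∈ S (M f) (f i)} then (m : ℝ) else 0) := by
        refine Finset.sum_le_sum (fun f _ => ?_)
        split_ifs with hf
        · have : #{i | i ∈ S (M f) (f i)} ≤ m := by
            simpa using Finset.card_le_univ ({i | i ∈ S (M f) (f i)} : Finset (Fin m))
          have : (#{i | i ∈ S (M f) (f i)} : ℝ) ≤ m := by exact_mod_cast this
          have : (0 : ℝ) ≤ T := by positivity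
          linarith
        · rw [add_zero]
          exact_mod_cast (not_le.mp hf).le
    _ = (Fintype.card G : ℝ) ^ m * T +
          (#{f : Fin m → G | T ≤ #{i | i ∈ S (M f) (f i)}} : ℝ) * m := by
        rw [Finset.sum_add_distrib, ← Finset.sum_filter]
        simp
    _ ≤ (Fintype.card G : ℝ) ^ m * T + (Fintype.card G : ℝ) ^ m / 8 * m := by gcongr
    _ = _ := by ring

/-! ### Agreement between random functions -/

/-- Few functions agree with a given one in many places. -/
theorem card_agree_le {a b : ℕ} (hb : 0 < b) (h : Fin a → Fin b) (t : ℕ) :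
    (#{g : Fin a → Fin b | t ≤ #{x | g x = h x}} : ℝ) * 2 ^ t ≤
      (b : ℝ) ^ a * Real.exp (a / b) := by
  refine (card_filter_mul_two_pow_le _ t).trans ?_
  have := sum_two_pow_card_le (ι := Fin a) (G := Fin b) (by simpa using hb) (fun x => {h x})
  simpa using this

/-- Fubini for two distinct coordinates of a uniformly random tuple. -/
theorem card_pair_le {G : Type*} [Fintype G] [DecidableEq G] {m : ℕ} {i j : Fin m} (hij : i ≠ j)
    (r : G → G → Prop) [DecidableRel r] (δ : ℝ)
    (hr : ∀ h, (#{g | r h g} : ℝ) ≤ δ * Fintype.card G) :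
    (#{f : Fin m → G | r (f i) (f j)} : ℝ) ≤ δ * (Fintype.card G : ℝ) ^ m := by
  classical
  have hc : (Fintype.card G : ℝ) ^ m =
      Fintype.card ({k : Fin m // k ≠ j} → G) * Fintype.card G := by
    have := Fintype.card_congr (Equiv.funSplitAt j G)
    rw [Fintype.card_prod, Fintype.card_fun, Fintype.card_fin] at this
    rw [mul_comm]
    exact_mod_cast this
  have h1 : (#{f : Fin m → G | r (f i) (f j)} : ℝ) =
      ∑ f : Fin m → G, if r (f i) (f j) then (1 : ℝ) else 0 := by simp
  rw [h1, Fintype.sum_equiv (Equiv.funSplitAt j G) _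
    (fun p => if r (p.2 ⟨i, hij⟩) p.1 then (1 : ℝ) else 0) (fun f => by simp),
    Fintype.sum_prod_type_right, hc]
  calc _ ≤ ∑ p : {k : Fin m // k ≠ j} → G, δ * (Fintype.card G : ℝ) := by
        refine Finset.sum_le_sum (fun p _ => ?_)
        simpa using hr (p ⟨i, hij⟩)
    _ = _ := by
        rw [Finset.sum_const, Finset.card_univ, nsmul_eq_mul]; ring

/-- It is rare that some `f j` agrees with `f i` in many places. -/
theorem card_exists_agree_le {a b m : ℕ} (hb : 0 < b) (t : ℕ) (i : Fin m)
    (ht : 8 * (m * Real.exp (a / b)) ≤ 2 ^ t) :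
    (#{f : Fin m → Fin a → Fin b | ∃ j, i ≠ j ∧ t ≤ #{x | f j x = f i x}} : ℝ) ≤
      (Fintype.card (Fin a → Fin b) : ℝ) ^ m / 8 := by
  obtain ⟨N, hN⟩ : ∃ N : ℝ, N = (Fintype.card (Fin a → Fin b) : ℝ) ^ m := ⟨_, rfl⟩
  rw [← hN]
  have hN0 : 0 ≤ N := by rw [hN]; positivity
  have h2 : (0 : ℝ) < 2 ^ t := by positivity
  have hj : ∀ j ∈ (univ.filter (fun j => i ≠ j) : Finset (Fin m)),
      (#{f : Fin m → Fin a → Fin b | t ≤ #{x | f j x = f i x}} : ℝ) ≤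
        Real.exp (a / b) / 2 ^ t * N := by
    intro j hj
    have hj : i ≠ j := by simpa using hj
    have hp := card_pair_le (G := Fin a → Fin b) hj (fun h g => t ≤ #{x | g x = h x})
      (Real.exp (a / b) / 2 ^ t) (fun h => by
        rw [div_mul_eq_mul_div, le_div_iff₀ h2]
        simpa [mul_comm] using card_agree_le hb h t)
    rw [← hN] at hp
    exact hp
  have hsub : ({f : Fin m → Fin a → Fin b | ∃ j, i ≠ j ∧ t ≤ #{x | f j x = f i x}} : Finset _) ⊆
      (univ.filter (fun j => i ≠ j) : Finset (Fin m)).biUnion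
        (fun j => {f : Fin m → Fin a → Fin b | t ≤ #{x | f j x = f i x}}) := by
    intro f hf
    simpa using hf
  calc _ ≤ ((#((univ.filter (fun j => i ≠ j) : Finset (Fin m)).biUnion
        (fun j => {f : Fin m → Fin a → Fin b | t ≤ #{x | f j x = f i x}})) : ℕ) : ℝ) := by
        exact_mod_cast Finset.card_le_card hsub
    _ ≤ ∑ j ∈ (univ.filter (fun j => i ≠ j) : Finset (Fin m)),
          (#{f : Fin m → Fin a → Fin b | t ≤ #{x | f j x = f i x}} : ℝ) := by
        exact_mod_cast Finset.card_biUnion_le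
    _ ≤ ∑ j ∈ (univ.filter (fun j => i ≠ j) : Finset (Fin m)), Real.exp (a / b) / 2 ^ t * N :=
        Finset.sum_le_sum hj
    _ ≤ ∑ j : Fin m, Real.exp (a / b) / 2 ^ t * N :=
        Finset.sum_le_sum_of_subset_of_nonneg (Finset.filter_subset _ _)
          (fun _ _ _ => by positivity)
    _ = (m * Real.exp (a / b)) / 2 ^ t * N := by simp; ring
    _ ≤ 1 / 8 * N := by
        refine mul_le_mul_of_nonneg_right ?_ hN0
        rw [div_le_iff₀ h2]; linarith
    _ = N / 8 := by ring

/-! ### The hard hypergraphs -/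

/-- The vertices of the graph of `g` in a grid placed in the vertex set by `φ`. -/
def graphEdge {n a b : ℕ} (φ : Fin a × Fin b ↪ Fin n) (g : Fin a → Fin b) : Finset (Fin n) :=
  univ.map ⟨fun x => φ (x, g x), fun x y h => by simpa using congrArg Prod.fst (φ.injective h)⟩

theorem mem_graphEdge {n a b : ℕ} (φ : Fin a × Fin b ↪ Fin n) (g : Fin a → Fin b) (v : Fin n) :
    v ∈ graphEdge φ g ↔ ∃ x, φ (x, g x) = v := by
  rw [graphEdge, Finset.mem_map]
  exact ⟨fun ⟨x, _, hx⟩ => ⟨x, hx⟩, fun ⟨x, hx⟩ => ⟨x, Finset.mem_univ x, hx⟩⟩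

theorem card_graphEdge {n a b : ℕ} (φ : Fin a × Fin b ↪ Fin n) (g : Fin a → Fin b) :
    #(graphEdge φ g) = a := by
  simp [graphEdge]

theorem card_graphEdge_inter_le {n a b : ℕ} (φ : Fin a × Fin b ↪ Fin n) (g h : Fin a → Fin b) :
    #(graphEdge φ h ∩ graphEdge φ g) ≤ #{x | g x = h x} := by
  have : graphEdge φ h ∩ graphEdge φ g ⊆
      ({x | g x = h x} : Finset (Fin a)).image (fun x => φ (x, h x)) := by
    intro v hv
    rw [Finset.mem_inter, mem_graphEdge, mem_graphEdge] at hv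
    obtain ⟨⟨x, rfl⟩, y, hy⟩ := hv
    have hxy := φ.injective hy
    obtain ⟨rfl, h2⟩ := Prod.mk.inj hxy
    exact Finset.mem_image.mpr ⟨y, by simpa using h2, rfl⟩
  exact (Finset.card_le_card this).trans Finset.card_image_le

/-- The stream of the graphs of `f 0, f 1, …`, closed by the complement of the graph of `f i`. -/
def hardStream {n a b m : ℕ} (φ : Fin a × Fin b ↪ Fin n) (f : Fin m → Fin a → Fin b) (i : Fin m) :
    Fin (m + 1) → Finset (Fin n) :=
  Fin.snoc (α := fun _ => Finset (Fin n)) (fun j => graphEdge φ (f j)) (graphEdge φ (f i))ᶜ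

@[simp]
theorem hardStream_castSucc {n a b m : ℕ} (φ : Fin a × Fin b ↪ Fin n)
    (f : Fin m → Fin a → Fin b) (i j : Fin m) :
    hardStream φ f i j.castSucc = graphEdge φ (f j) := by
  simp [hardStream]

@[simp]
theorem hardStream_last {n a b m : ℕ} (φ : Fin a × Fin b ↪ Fin n)
    (f : Fin m → Fin a → Fin b) (i : Fin m) :
    hardStream φ f i (Fin.last m) = (graphEdge φ (f i))ᶜ := by
  simp [hardStream]

/-- The hypergraph of the stream `hardStream φ f i`. -/
def hardHypergraph {n a b m : ℕ} (φ : Fin a × Fin b ↪ Fin n) (ha : 0 < a) (hb : 2 ≤ b)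
    (f : Fin m → Fin a → Fin b) (i : Fin m) : StreamHypergraph n (m + 1) where
  edge := hardStream φ f i
  edge_nonempty := by
    intro t
    induction t using Fin.lastCases with
    | last =>
      rw [hardStream_last]
      -- A second value at one point, available since `b ≥ 2`, gives a vertex off the graph.
      have : Nontrivial (Fin b) := Fin.nontrivial_iff_two_le.mpr hb
      obtain ⟨y, hy⟩ := exists_ne (f i ⟨0, ha⟩)
      refine ⟨φ (⟨0, ha⟩, y), ?_⟩
      rw [Finset.mem_compl, mem_graphEdge]
      rintro ⟨x, hx⟩
      obtain ⟨rfl, h2⟩ := Prod.mk.inj (φ.injective hx)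
      exact hy h2.symm
    | cast j =>
      rw [hardStream_castSucc, ← Finset.card_pos, card_graphEdge]
      exact ha
  no_isolated := by
    intro v
    by_cases hv : v ∈ graphEdge φ (f i)
    · exact ⟨i.castSucc, by simpa using hv⟩
    · exact ⟨Fin.last m, by simpa using hv⟩

theorem optCard_hardHypergraph_le {n a b m : ℕ} (φ : Fin a × Fin b ↪ Fin n) (ha : 0 < a)
    (hb : 2 ≤ b) (f : Fin m → Fin a → Fin b) (i : Fin m) :
    (hardHypergraph φ ha hb f i).optCard ≤ 2 := by
  have h : (hardHypergraph φ ha hb f i).IsCover 1 {i.castSucc, Fin.last m} := by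
    have : (hardHypergraph φ ha hb f i).coveredBy {i.castSucc, Fin.last m} = univ := by
      simp [StreamHypergraph.coveredBy, hardHypergraph, Finset.biUnion_insert]
    rw [StreamHypergraph.IsCover, this]
    simp
  have h' : (hardHypergraph φ ha hb f i).optCard ≤ #{i.castSucc, Fin.last m} :=
    Nat.sInf_le ⟨_, h, rfl⟩
  exact h'.trans Finset.card_le_two

/-- A cover that misses the edge `i` is large if the other edges meet the edge `i` in few
vertices. -/
theorem le_card_mul_of_isCover {n a b m : ℕ} (φ : Fin a × Fin b ↪ Fin n) (ha : 0 < a)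
    (hb : 2 ≤ b) (f : Fin m → Fin a → Fin b) (i : Fin m) (ε : ℝ) (F : Finset (Fin (m + 1)))
    (hF : (hardHypergraph φ ha hb f i).IsCover (1 - ε) F) (hi : i.castSucc ∉ F) (t : ℕ)
    (ht : ∀ j, i ≠ j → #{x | f j x = f i x} < t) :
    (a : ℝ) - ε * n ≤ #F * t := by
  set U := (hardHypergraph φ ha hb f i).coveredBy F with hU
  have h1 : #(graphEdge φ (f i) ∩ U) ≤ #F * t := by
    rw [hU, StreamHypergraph.coveredBy, Finset.inter_biUnion]
    refine Finset.card_biUnion_le_card_mul _ _ _ (fun k hk => ?_)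
    change #(graphEdge φ (f i) ∩ hardStream φ f i k) ≤ t
    induction k using Fin.lastCases with
    -- The last edge is the complement of the graph of `f i`, hence disjoint from it.
    | last => simp
    | cast j =>
      rw [hardStream_castSucc]
      refine (card_graphEdge_inter_le φ _ _).trans (ht j ?_).le
      rintro rfl
      exact hi hk
  have h2 : a ≤ #(graphEdge φ (f i) ∩ U) + #Uᶜ := by
    refine (card_graphEdge φ (f i)).symm.le.trans ?_
    rw [← Finset.card_inter_add_card_sdiff (graphEdge φ (f i)) U]
    refine Nat.add_le_add_left (Finset.card_le_card fun v hv => ?_) _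
    simpa using (Finset.mem_sdiff.mp hv).2
  have h3 : (#Uᶜ : ℝ) ≤ ε * n := by
    have h4 : #U + #Uᶜ = n := by simp
    have h4' : (#U : ℝ) + #Uᶜ = n := by exact_mod_cast h4
    have h5 : (1 - ε) * (n : ℝ) ≤ #U := hF
    linarith
  have h1' : (#(graphEdge φ (f i) ∩ U) : ℝ) ≤ #F * t := by exact_mod_cast h1
  have h2' : (a : ℝ) ≤ #(graphEdge φ (f i) ∩ U) + #Uᶜ := by exact_mod_cast h2
  linarith

/-! ### Deterministic algorithms on random hard streams -/

/-- The memory image before the last edge of `hardStream φ f i`. -/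
def StreamAlg.memoryAfter {n s a b m : ℕ} (A : StreamAlg n s) (φ : Fin a × Fin b ↪ Fin n)
    (f : Fin m → Fin a → Fin b) : Fin s → Bool :=
  Fin.foldl m (fun mem t => A.update t (graphEdge φ (f t)) mem) A.init

/-- The output at the end of `hardStream φ f i`, from the memory image before the last edge and
from `g = f i`. -/
def StreamAlg.finalOutput {n s a b : ℕ} (A : StreamAlg n s) (φ : Fin a × Fin b ↪ Fin n) (m : ℕ)
    (mem : Fin s → Bool) (g : Fin a → Fin b) : Finset (Fin (m + 1)) :=
  A.output (m + 1) (A.update m (graphEdge φ g)ᶜ mem)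

/-- The memory before the last edge does not depend on `i`, so `i` influences the output only
through `f i`. -/
theorem StreamAlg.run_hardStream {n s a b m : ℕ} (A : StreamAlg n s)
    (φ : Fin a × Fin b ↪ Fin n) (f : Fin m → Fin a → Fin b) (i : Fin m) :
    A.run (hardStream φ f i) = A.finalOutput φ m (A.memoryAfter φ f) (f i) := by
  simp [StreamAlg.run, Fin.foldl_succ_last, finalOutput, memoryAfter]

/-- A deterministic algorithm that outputs a `(1 - ε)`-cover on all hard streams has large outputs
on average. -/
theorem StreamAlg.le_sum_card_run {n s a b m : ℕ} (A : StreamAlg n s)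
    (φ : Fin a × Fin b ↪ Fin n) (ha : 0 < a) (hb : 2 ≤ b) (ε R : ℝ) (hR : 0 ≤ R) (t T : ℕ)
    (hm : m = 8 * T) (hT : 8 * (2 ^ s * Real.exp R) ≤ 2 ^ T)
    (ht : 8 * (m * Real.exp (a / b)) ≤ 2 ^ t) (hRt : R * t < a - ε * n)
    (hA : ∀ (f : Fin m → Fin a → Fin b) (i : Fin m),
      (hardHypergraph φ ha hb f i).IsCover (1 - ε) (A.run (hardStream φ f i))) :
    R / 2 * ((Fintype.card (Fin a → Fin b) : ℝ) ^ m * m) ≤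
      ∑ f : Fin m → Fin a → Fin b, ∑ i, (#(A.run (hardStream φ f i)) : ℝ) := by
  classical
  obtain ⟨N, hN⟩ : ∃ N : ℝ, N = (Fintype.card (Fin a → Fin b) : ℝ) ^ m := ⟨_, rfl⟩
  have hN0 : 0 ≤ N := by rw [hN]; positivity
  -- Outputs larger than `R` are replaced by the empty guess, so that the size bound holds for all
  -- `mem` and `g`.
  let S : (Fin s → Bool) → (Fin a → Fin b) → Finset (Fin m) := fun mem g =>
    if (#(A.finalOutput φ m mem g) : ℝ) ≤ R then
      ({i | Fin.castSucc i ∈ A.finalOutput φ m mem g} : Finset (Fin m)) else ∅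
  have hS : ∀ mem g, (#(S mem g) : ℝ) ≤ R := by
    intro mem g
    by_cases h : (#(A.finalOutput φ m mem g) : ℝ) ≤ R
    · simp only [S, if_pos h]
      refine le_trans ?_ h
      have : #({i | i.castSucc ∈ A.finalOutput φ m mem g} : Finset (Fin m)) ≤
          #(A.finalOutput φ m mem g) :=
        Finset.card_le_card_of_injOn Fin.castSucc (fun i hi => by simpa using hi)
          (Fin.castSucc_injective m).injOn
      exact_mod_cast this
    · simpa only [S, if_neg h, Finset.card_empty, Nat.cast_zero] using hR
  have hG : 0 < Fintype.card (Fin a → Fin b) := by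
    rw [Fintype.card_fun, Fintype.card_fin, Fintype.card_fin]
    exact pow_pos (by omega) _
  have hguess := sum_correct_guesses_le hG (A.memoryAfter φ) S R hS T (by simpa using hT)
  rw [← hN] at hguess
  have hagree : ∑ i : Fin m, (#{f : Fin m → Fin a → Fin b |
      ∃ j, i ≠ j ∧ t ≤ #{x | f j x = f i x}} : ℝ) ≤ m * (N / 8) := by
    calc _ ≤ ∑ i : Fin m, N / 8 := Finset.sum_le_sum (fun i _ => by
            rw [hN]; exact card_exists_agree_le (by omega) t i ht)
      _ = _ := by simp
  -- The output has size at least `R` outside two bad events: a correct guess (average at most `1/8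
  -- + 1/8`) and a large agreement (at most `1/8`). The remaining weight `5/8` exceeds the `1/2`
  -- claimed.
  have hpt : ∀ (f : Fin m → Fin a → Fin b) (i : Fin m),
      R ≤ #(A.run (hardStream φ f i)) + R * (if i ∈ S (A.memoryAfter φ f) (f i) then 1 else 0)
        + R * (if ∃ j, i ≠ j ∧ t ≤ #{x | f j x = f i x} then 1 else 0) := by
    intro f i
    have h0 : (0 : ℝ) ≤ #(A.run (hardStream φ f i)) := by positivity
    by_cases h1 : i ∈ S (A.memoryAfter φ f) (f i)
    · rw [if_pos h1]
      split_ifs <;> linarith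
    by_cases h2 : ∃ j, i ≠ j ∧ t ≤ #{x | f j x = f i x}
    · rw [if_pos h2, if_neg h1]
      linarith
    rw [if_neg h1, if_neg h2]
    by_contra hlt
    have hlt : (#(A.run (hardStream φ f i)) : ℝ) < R := by linarith
    have hi : i.castSucc ∉ A.run (hardStream φ f i) := by
      intro hi
      apply h1
      rw [A.run_hardStream] at hi hlt
      simp only [S, if_pos hlt.le]
      simpa using hi
    have := le_card_mul_of_isCover φ ha hb f i ε _ (hA f i) hi t
      (fun j hj => not_le.mp fun hle => h2 ⟨j, hj, hle⟩)
    have : (#(A.run (hardStream φ f i)) : ℝ) * t ≤ R * t := by gcongr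
    linarith
  have hsum : ∑ f : Fin m → Fin a → Fin b, ∑ i : Fin m, R ≤
      ∑ f : Fin m → Fin a → Fin b, ∑ i, (#(A.run (hardStream φ f i)) : ℝ) +
      R * ∑ f : Fin m → Fin a → Fin b, (#{i | i ∈ S (A.memoryAfter φ f) (f i)} : ℝ) +
      R * ∑ i : Fin m, (#{f : Fin m → Fin a → Fin b |
        ∃ j, i ≠ j ∧ t ≤ #{x | f j x = f i x}} : ℝ) := by
    calc _ ≤ ∑ f : Fin m → Fin a → Fin b, ∑ i : Fin m, _ :=
          Finset.sum_le_sum (fun f _ => Finset.sum_le_sum (fun i _ => hpt f i))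
      _ = _ := by
          simp only [Finset.sum_add_distrib, ← Finset.mul_sum, Finset.sum_boole]
          congr 2
          simp only [← Finset.sum_boole]
          exact Finset.sum_comm
  have hcard : ∑ f : Fin m → Fin a → Fin b, ∑ i : Fin m, R = N * m * R := by
    rw [hN]
    simp [mul_assoc]
  rw [hcard] at hsum
  rw [← hN]
  have hTm : (T : ℝ) = m / 8 := by rw [hm]; push_cast; ring
  rw [hTm] at hguess
  have e1 := mul_le_mul_of_nonneg_left hguess hR
  have e2 := mul_le_mul_of_nonneg_left hagree hR
  have e3 : 0 ≤ R * (N * m) := by positivity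
  linarith

/-! ### Randomized algorithms -/

theorem RandStreamAlg.integrable_card_run {n s m : ℕ} (A : RandStreamAlg.{u} n s)
    (edge : Fin m → Finset (Fin n)) :
    Integrable (fun ω => (#((A.alg ω).run edge) : ℝ)) A.P := by
  let _ : MeasurableSpace (Finset (Fin m)) := ⊤
  have h1 : Measurable (fun ω => (A.alg ω).run edge) :=
    measurable_to_countable' (fun F => A.measurableSet_run m edge F)
  have h2 : Measurable (fun ω => (#((A.alg ω).run edge) : ℝ)) :=
    (measurable_from_top (f := fun F : Finset (Fin m) => (#F : ℝ))).comp h1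
  refine Integrable.of_bound h2.aestronglyMeasurable (m : ℝ) (Filter.Eventually.of_forall ?_)
  intro ω
  rw [Real.norm_of_nonneg (by positivity)]
  have : #((A.alg ω).run edge) ≤ m := by
    simpa using Finset.card_le_univ ((A.alg ω).run edge)
  exact_mod_cast this

/-- The approximation ratio is at least one. -/
theorem RandStreamAlg.IsUncertified.one_le {n s M : ℕ} {A : RandStreamAlg.{u} n s} {ε ρ : ℝ}
    (hA : A.IsUncertified M ε ρ) (hn : 0 < n) (hM : 1 ≤ M) (hε : ε < 1) : 1 ≤ ρ := by
  let G : StreamHypergraph n 1 :=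
    { edge := fun _ => univ
      edge_nonempty := fun _ => ⟨⟨0, hn⟩, Finset.mem_univ _⟩
      no_isolated := fun v => ⟨0, Finset.mem_univ v⟩ }
  obtain ⟨hcov, hint⟩ := hA 1 hM G
  have hopt : G.optCard ≤ 1 := by
    refine Nat.sInf_le ⟨{0}, ?_, by simp⟩
    simp [StreamHypergraph.IsCover, StreamHypergraph.coveredBy, G]
  have h1 : (1 : ℝ) ≤ ∫ ω, (#((A.alg ω).run G.edge) : ℝ) ∂A.P := by
    calc (1 : ℝ) = ∫ _, (1 : ℝ) ∂A.P := by simp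
      _ ≤ _ := by
        refine integral_mono_ae (integrable_const _) (A.integrable_card_run _) ?_
        filter_upwards [hcov] with ω hω
        have hpos : (0 : ℝ) < (1 - ε) * n := by
          have : (0 : ℝ) < n := by exact_mod_cast hn
          exact mul_pos (by linarith) this
        have hne : ((A.alg ω).run G.edge).Nonempty := by
          rw [Finset.nonempty_iff_ne_empty]
          intro h0
          rw [StreamHypergraph.IsCover, h0] at hω
          simp only [StreamHypergraph.coveredBy, Finset.biUnion_empty, Finset.card_empty,
            Nat.cast_zero] at hω
          linarith
        exact_mod_cast hne.card_pos
  have h2 := h1.trans hint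
  rcases Nat.le_one_iff_eq_zero_or_eq_one.mp hopt with h0 | h0 <;> rw [h0] at h2 <;> norm_num at h2
  exact h2

/-- Averaging the deterministic bound over the coin tosses. -/
theorem RandStreamAlg.IsUncertified.le_of_grid {n s M a b m : ℕ} {A : RandStreamAlg.{u} n s}
    {ε ρ : ℝ} (hA : A.IsUncertified M ε ρ) (hρ : 0 ≤ ρ) (φ : Fin a × Fin b ↪ Fin n) (ha : 0 < a)
    (hb : 2 ≤ b) (R : ℝ) (hR : 0 ≤ R) (t T : ℕ) (hT0 : 0 < T) (hm : m = 8 * T) (hM : m + 1 ≤ M)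
    (hT : 8 * (2 ^ s * Real.exp R) ≤ 2 ^ T)
    (ht : 8 * (m * Real.exp (a / b)) ≤ 2 ^ t) (hRt : R * t < a - ε * n) :
    R / 4 ≤ ρ := by
  obtain ⟨N, hN⟩ : ∃ N : ℝ, N = (Fintype.card (Fin a → Fin b) : ℝ) ^ m * m := ⟨_, rfl⟩
  have hN0 : 0 < N := by
    have hb' : 0 < b := by omega
    have hm' : 0 < m := by omega
    rw [hN, Fintype.card_fun, Fintype.card_fin, Fintype.card_fin]
    push_cast
    positivity
  -- There are finitely many hard streams, so one null set serves them all.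
  have hcov : ∀ᵐ ω ∂A.P, ∀ (f : Fin m → Fin a → Fin b) (i : Fin m),
      (hardHypergraph φ ha hb f i).IsCover (1 - ε) ((A.alg ω).run (hardStream φ f i)) := by
    rw [ae_all_iff]
    intro f
    rw [ae_all_iff]
    intro i
    exact (hA (m + 1) hM (hardHypergraph φ ha hb f i)).1
  have hlow : R / 2 * N ≤
      ∫ ω, ∑ f : Fin m → Fin a → Fin b, ∑ i, (#((A.alg ω).run (hardStream φ f i)) : ℝ) ∂A.P := by
    calc R / 2 * N = ∫ _, R / 2 * N ∂A.P := by simp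
      _ ≤ _ := by
        refine integral_mono_ae (integrable_const _)
          (integrable_finsetSum _ fun f _ => integrable_finsetSum _ fun i _ =>
            A.integrable_card_run _) ?_
        filter_upwards [hcov] with ω hω
        rw [hN]
        exact (A.alg ω).le_sum_card_run φ ha hb ε R hR t T hm hT ht hRt hω
  have hup : ∫ ω, ∑ f : Fin m → Fin a → Fin b, ∑ i,
      (#((A.alg ω).run (hardStream φ f i)) : ℝ) ∂A.P ≤ N * (ρ * 2) := by
    rw [integral_finsetSum _ fun f _ => integrable_finsetSum _ fun i _ =>
      A.integrable_card_run _]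
    calc _ ≤ ∑ f : Fin m → Fin a → Fin b, ∑ i : Fin m, ρ * 2 := by
          refine Finset.sum_le_sum fun f _ => ?_
          rw [integral_finsetSum _ fun i _ => A.integrable_card_run _]
          refine Finset.sum_le_sum fun i _ => ?_
          refine (hA (m + 1) hM (hardHypergraph φ ha hb f i)).2.trans ?_
          have := optCard_hardHypergraph_le φ ha hb f i
          refine mul_le_mul_of_nonneg_left ?_ hρ
          exact_mod_cast this
      _ = N * (ρ * 2) := by
          rw [hN]
          simp [mul_assoc]
  have h := hlow.trans hup
  rw [mul_comm] at h
  have := le_of_mul_le_mul_left h hN0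
  linarith

/-! ### Choice of parameters -/

/-- The hard streams for a given `n` and `ε`. -/
theorem RandStreamAlg.IsUncertified.inv_le {n s : ℕ} {A : RandStreamAlg.{u} n s} {ε ρ : ℝ}
    (hA : A.IsUncertified (n ^ 4) ε ρ) (hn : 64 ≤ n) (hε : ε < 1 / 8)
    (hlog : 3 * Real.log n ≤ ε ^ 2 * n) (hεn : 1 ≤ ε * n) (hx : 1 ≤ ε ^ 2 * n)
    (hs : (s : ℝ) ≤ n ^ 2 / 4) :
    1 / 3200 * (1 / ε) ≤ ρ := by
  have hn' : (64 : ℝ) ≤ n := by exact_mod_cast hn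
  have hn0 : (0 : ℝ) < n := by linarith
  have hε0 : 0 < ε := by
    by_contra h
    nlinarith
  have hρ : 1 ≤ ρ := hA.one_le (by omega) (Nat.one_le_pow _ _ (by omega)) (by linarith)
  obtain ⟨y, hy⟩ : ∃ y : ℝ, y = 1 / (4 * ε) := ⟨_, rfl⟩
  have hyε : y * ε = 1 / 4 := by rw [hy]; field_simp
  have hy2 : 2 < y := by
    by_contra h
    nlinarith
  obtain ⟨b, hb⟩ : ∃ b : ℕ, b = ⌊y⌋₊ := ⟨_, rfl⟩
  have hb2 : 2 ≤ b := by
    rw [hb]; exact Nat.le_floor (by exact_mod_cast hy2.le)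
  have hb0 : (0 : ℝ) < b := by
    have : 0 < b := by omega
    exact_mod_cast this
  have hby : (b : ℝ) ≤ y := by rw [hb]; exact Nat.floor_le (by linarith)
  have hyb : y / 2 ≤ b := by
    have := Nat.sub_one_lt_floor y
    rw [← hb] at this
    linarith
  have hbinv : 1 / (b : ℝ) ≤ 8 * ε := by
    rw [div_le_iff₀ hb0]
    nlinarith
  have hbinv' : 4 * ε ≤ 1 / (b : ℝ) := by
    rw [le_div_iff₀ hb0]
    nlinarith
  obtain ⟨a, ha⟩ : ∃ a : ℕ, a = n / b := ⟨_, rfl⟩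
  have hab : a * b ≤ n := by rw [ha]; exact Nat.div_mul_le_self n b
  have ha_le : (a : ℝ) ≤ n / b := by rw [ha]; exact Nat.cast_div_le
  have hle_a : 3 * (ε * n) ≤ a := by
    have h := Nat.sub_one_lt_floor ((n : ℝ) / b)
    rw [Nat.floor_div_natCast, Nat.floor_natCast, ← ha] at h
    have : 4 * ε * n ≤ n / b := by
      rw [div_eq_mul_one_div, mul_comm (n : ℝ)]
      gcongr
    linarith
  have ha0 : 0 < a := by
    have : (0 : ℝ) < a := by linarith
    exact_mod_cast this
  have hdiv : (a : ℝ) / b ≤ 64 * (ε ^ 2 * n) := by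
    calc (a : ℝ) / b ≤ n / b / b := by gcongr
      _ = n * (1 / b) * (1 / b) := by ring
      _ ≤ n * (8 * ε) * (8 * ε) := by gcongr
      _ = _ := by ring
  -- The condition on `t` needs `2^t ≥ exp(65 ε²n)`: `64` bounds `a/b`, and the extra `1` absorbs
  -- `8m`. Rounding up costs at most a factor 2, since `ε²n ≥ 1`.
  obtain ⟨t, ht⟩ : ∃ t : ℕ, t = ⌈400 * (ε ^ 2 * n)⌉₊ := ⟨_, rfl⟩
  have ht1 : 400 * (ε ^ 2 * n) ≤ t := by rw [ht]; exact Nat.le_ceil _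
  have ht2 : (t : ℝ) ≤ 800 * (ε ^ 2 * n) := by
    have := Nat.ceil_lt_add_one (a := 400 * (ε ^ 2 * n)) (by positivity)
    rw [← ht] at this
    linarith
  have hlog2 := Real.log_two_gt_d9
  have two_pow : ∀ k : ℕ, (2 : ℝ) ^ k = Real.exp (k * Real.log 2) := by
    intro k
    rw [Real.exp_nat_mul, Real.exp_log (by norm_num)]
  let φ : Fin a × Fin b ↪ Fin n :=
    finProdFinEquiv.toEmbedding.trans (Fin.castLEEmb hab)
  -- `R = 1/(800ε)` makes `R * t ≤ εn`, below `a - εn ≥ 2εn`.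
  have hR := hA.le_of_grid (m := 8 * n ^ 2) (by linarith) φ ha0 hb2 (1 / (800 * ε))
    (by positivity) t (n ^ 2) (by positivity) rfl ?_ ?_ ?_ ?_
  · calc 1 / 3200 * (1 / ε) = 1 / (800 * ε) / 4 := by field_simp; norm_num
      _ ≤ ρ := hR
  · nlinarith [Nat.pow_le_pow_left hn 2]
  · have hR1 : 1 / (800 * ε) ≤ n := by
      rw [div_le_iff₀ (by positivity)]
      nlinarith
    have h8 : (8 : ℝ) = Real.exp ((3 : ℕ) * Real.log 2) := by
      rw [← two_pow]; norm_num
    rw [two_pow, two_pow, ← Real.exp_add, h8, ← Real.exp_add, Real.exp_le_exp]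
    push_cast
    have hn2 : (64 : ℝ) * n ≤ n ^ 2 := by nlinarith
    nlinarith
  -- This is where `ε²n ≥ 3 log n` enters: the union bound runs over polynomially many edges.
  · have hm : (8 : ℝ) * (8 * n ^ 2) ≤ Real.exp (ε ^ 2 * n) := by
      calc (8 : ℝ) * (8 * n ^ 2) ≤ n ^ 3 := by nlinarith [sq_nonneg (n : ℝ)]
        _ = Real.exp ((3 : ℕ) * Real.log n) := by rw [Real.exp_nat_mul, Real.exp_log hn0]
        _ ≤ _ := Real.exp_le_exp.mpr (by exact_mod_cast hlog)
    push_cast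
    calc (8 : ℝ) * (8 * n ^ 2 * Real.exp (a / b))
        = 8 * (8 * n ^ 2) * Real.exp (a / b) := by ring
      _ ≤ Real.exp (ε ^ 2 * n) * Real.exp (64 * (ε ^ 2 * n)) := by gcongr
      _ = Real.exp (65 * (ε ^ 2 * n)) := by rw [← Real.exp_add]; ring_nf
      _ ≤ 2 ^ t := by
        rw [two_pow, Real.exp_le_exp]
        nlinarith
  · have : 1 / (800 * ε) * t ≤ ε * n := by
      calc 1 / (800 * ε) * t ≤ 1 / (800 * ε) * (800 * (ε ^ 2 * n)) := by gcongr
        _ = ε * n := by field_simp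
    linarith

theorem eventually_three_mul_log_le {α : ℝ} (hα : 0 < α) :
    ∀ᶠ n : ℕ in Filter.atTop, 3 * Real.log n ≤ (n : ℝ) ^ (2 * α) := by
  have h := (isLittleO_log_rpow_atTop (r := 2 * α) (by positivity)).bound
    (show (0 : ℝ) < 1 / 3 by norm_num)
  have h' := tendsto_natCast_atTop_atTop (R := ℝ) |>.eventually h
  filter_upwards [h', Filter.eventually_ge_atTop 1] with n hn h1
  have h1' : (1 : ℝ) ≤ n := by exact_mod_cast h1
  rw [Real.norm_of_nonneg (Real.log_nonneg h1'), Real.norm_of_nonneg (by positivity)] at hn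
  linarith

theorem log_log_div_log_le_one {x : ℝ} (hx : 1 < x) :
    Real.log (Real.log x) / Real.log x ≤ 1 := by
  have h := Real.log_pos hx
  rw [div_le_one h]
  linarith [Real.log_le_sub_one_of_pos h]

end EdgeCover

theorem mainTheorem6 :
    ∃ K : ℕ, ∀ α : ℝ, 0 < α → ∃ κ : ℝ, 0 < κ ∧ ∃ c : ℝ, 0 < c ∧
      ∀ n₀ : ℕ, ∃ n : ℕ, n₀ ≤ n ∧
        ∀ ε : ℝ, (n : ℝ) ^ (-(1 / 2) + α : ℝ) ≤ ε → ε < 1 →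
          ∀ s : ℕ, (s : ℝ) ≤ κ * (n : ℝ) ^ (1 + α : ℝ) →
            ∀ ρ : ℝ, (∃ A : EdgeCover.RandStreamAlg.{u} n s, A.IsUncertified (n ^ K) ε ρ) →
              c * (Real.log (Real.log n) / Real.log n * (1 / ε)) ≤ ρ := by
  refine ⟨4, fun α hα => ⟨1, one_pos, 1 / 3200, by norm_num, fun n₀ => ?_⟩⟩
  obtain ⟨n, hlog, hn, hn₀⟩ := ((EdgeCover.eventually_three_mul_log_le hα).and
    ((Filter.eventually_ge_atTop 64).and (Filter.eventually_ge_atTop n₀))).exists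
  refine ⟨n, hn₀, fun ε hε hε1 s hs ρ ⟨A, hA⟩ => ?_⟩
  have hn' : (64 : ℝ) ≤ n := by exact_mod_cast hn
  have hn0 : (0 : ℝ) < n := by linarith
  have hn1 : (1 : ℝ) ≤ n := by linarith
  have hε0 : 0 < ε := lt_of_lt_of_le (Real.rpow_pos_of_pos hn0 _) hε
  have hll : 1 / 3200 * (Real.log (Real.log n) / Real.log n * (1 / ε)) ≤
      1 / 3200 * (1 / ε) := by
    have := mul_le_mul_of_nonneg_right
      (EdgeCover.log_log_div_log_le_one (x := n) (by linarith)) (one_div_pos.mpr hε0).le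
    linarith
  refine hll.trans ?_
  -- For `ε ≥ 1/8` the trivial bound `ρ ≥ 1` suffices.
  rcases le_or_gt (1 / 8) ε with h8 | h8
  · have hρ : 1 ≤ ρ := hA.one_le (by omega) (Nat.one_le_pow _ _ (by omega)) hε1
    have : 1 / ε ≤ 8 := by
      rw [div_le_iff₀ hε0]; linarith
    linarith
  -- Otherwise no `ε < 1` is admissible. Hence the memory is at most `n^(3/2) ≤ n²/4`, and `κ = 1`
  -- works.
  have hα2 : α < 1 / 2 := by
    by_contra h
    have := Real.one_le_rpow hn1 (show 0 ≤ -(1 / 2) + α by linarith)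
    linarith
  have hsq : (n : ℝ) ^ (2 * α) ≤ ε ^ 2 * n := by
    calc (n : ℝ) ^ (2 * α) = ((n : ℝ) ^ (-(1 / 2) + α : ℝ)) ^ 2 * n := by
          rw [← Real.rpow_natCast, ← Real.rpow_mul hn0.le]
          nth_rewrite 3 [← Real.rpow_one (n : ℝ)]
          rw [← Real.rpow_add hn0]
          congr 1
          push_cast
          ring
      _ ≤ ε ^ 2 * n := by gcongr
  have hx : 1 ≤ ε ^ 2 * n := (Real.one_le_rpow hn1 (by positivity)).trans hsq
  refine hA.inv_le hn h8 (hlog.trans hsq) ?_ hx ?_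
  · nlinarith
  · have h1 : (n : ℝ) ^ (1 + α : ℝ) ≤ n * √n := by
      calc (n : ℝ) ^ (1 + α : ℝ) ≤ (n : ℝ) ^ (1 + 1 / 2 : ℝ) :=
            Real.rpow_le_rpow_of_exponent_le hn1 (by linarith)
        _ = n * √n := by rw [Real.rpow_add hn0, Real.rpow_one, Real.sqrt_eq_rpow]
    have h2 : √(n : ℝ) * √n = n := Real.mul_self_sqrt hn0.le
    have h3 : 8 ≤ √(n : ℝ) := Real.le_sqrt_of_sq_le (by linarith)
    have h4 : √(n : ℝ) ≤ n / 4 := by nlinarith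
    nlinarith
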